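/- Let $\Phi : M_n(\mathbb{C}) \to M_m(\mathbb{C})$ be a quantum channel, that is, a completely positive and trace preserving linear map, and let $V_1,\dots,V_d \in M_{m\times n}(\mathbb{C})$ be any finite family of Kraus operators for $\Phi$, so that $\Phi(X) = \sum_i V_i X V_i^*$ for all $X \in M_n(\mathbb{C})$. Let $\mathcal{B} \subseteq M_n(\mathbb{C})$ be a unital $*$-subalgebra (i.e. $I_n \in \mathcal{B}$ and $\mathcal{B}$ is closed under adjoints) that is privatized to a state by $\Phi$: there is a density matrix $\rho \in M_m(\mathbb{C})$ (positive semidefinite with trace $1$) such that $\Phi(A) = \mathrm{Tr}(A)\,\rho$ for all $A \in \mathcal{B}$. Then $$\dim(\mathcal{B}) \le \dim\bigl(\{V_i^*V_j\}''\bigr),$$ where $\{V_i^*V_j\}''$ is the double commutant in $M_n(\mathbb{C})$ of the set of all operators $V_i^*V_j$, $1 \le i,j \le d$. Likewise, $\dim(\mathcal{B})$ is at most the dimension of the unital subalgebra of $M_n(\mathbb{C})$ generated by the operators $V_i^*V_j$. All dimensions are complex vector space dimensions. -/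

import Mathlib

open scoped Matrix.Norms.L2Operator MatrixOrder ComplexOrder Matrix

/-- A quantum channel `Φ : M_n → M_m`: a completely positive, trace preserving linear map
between complex matrix algebras. The matrix algebras carry their usual C⋆-algebra structure
and the Loewner order. -/
structure QuantumChannel (n m : ℕ) extends
    CompletelyPositiveMap (Matrix (Fin n) (Fin n) ℂ) (Matrix (Fin m) (Fin m) ℂ) where
  trace_map : ∀ X : Matrix (Fin n) (Fin n) ℂ, (toLinearMap X).trace = X.trace

namespace QuantumChannel

variable {n m : ℕ}

/-- The finite family `V` is a family of Kraus operators for `Φ`: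
`Φ(X) = ∑ i, V_i X V_i^*` for every `X`. -/
def IsKrausFamily (Φ : QuantumChannel n m) {ι : Type*} [Fintype ι]
    (V : ι → Matrix (Fin m) (Fin n) ℂ) : Prop :=
  ∀ X : Matrix (Fin n) (Fin n) ℂ, Φ.toLinearMap X = ∑ i, V i * X * (V i)ᴴ

/-- The unital ⋆-subalgebra `B` of `M_n` is privatized to a state by `Φ`: there is a density
matrix `ρ` such that `Φ(A) = Tr(A) ρ` for all `A ∈ B`. -/
def PrivatizesToState (Φ : QuantumChannel n m)
    (B : StarSubalgebra ℂ (Matrix (Fin n) (Fin n) ℂ)) : Prop :=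
  ∃ ρ : Matrix (Fin m) (Fin m) ℂ, ρ.PosSemidef ∧ ρ.trace = 1 ∧
    ∀ A ∈ B, Φ.toLinearMap A = A.trace • ρ

end QuantumChannel

/-- The set of operators `V_i^* V_j`, over all pairs `i, j`. -/
def krausProducts {n m : ℕ} {ι : Type*} (V : ι → Matrix (Fin m) (Fin n) ℂ) :
    Set (Matrix (Fin n) (Fin n) ℂ) :=
  Set.range fun p : ι × ι => (V p.1)ᴴ * V p.2

/-- The double commutant `S″` of a set of matrices, as a subalgebra of `M_n`. -/
def doubleCommutant {n : ℕ} (S : Set (Matrix (Fin n) (Fin n) ℂ)) :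
    Subalgebra ℂ (Matrix (Fin n) (Fin n) ℂ) :=
  Subalgebra.centralizer ℂ
    (Subalgebra.centralizer ℂ S : Set (Matrix (Fin n) (Fin n) ℂ))

open Module

/-! Let `A` be the algebra generated by the `V_i^* V_j`, and `c` in its commutant. Some `P`
satisfies `V_i c = P V_i`, so `Φ(cY) = PΦ(Y) = Tr(Y) Pρ` for `Y ∈ B`. Taking traces, with `Y = 1` to
fix the constant, gives `n Tr(bc) = Tr(b) Tr(c)`: `B` is quasiorthogonal to the commutant of `A`.
For a basis `a_i` of `A` orthonormal for the regular trace, `Y ↦ ∑ a_i^* Y a_i` is the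
Hilbert–Schmidt projection onto that commutant, hence scalar on `B`. With `b_k` a Hilbert–Schmidt
orthonormal basis of `B`, two Cauchy–Schwarz estimates on `X_i = ∑ b_k a_i b_k^*` give `(dim B)² ≤
dim A · dim B`. -/

theorem exists_basis_repr_eq_inner {V : Type*} [AddCommGroup V] [Module ℂ V]
    [FiniteDimensional ℂ V] (core : InnerProductSpace.Core ℂ V) :
    ∃ b : Basis (Fin (finrank ℂ V)) ℂ V, ∀ x i, b.repr x i = core.inner (b i) x := by
  let _ : NormedAddCommGroup V := core.toNormedAddCommGroup
  let _ : InnerProductSpace ℂ V := InnerProductSpace.ofCore core.toCore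
  refine ⟨(stdOrthonormalBasis ℂ V).toBasis, fun x i => ?_⟩
  rw [OrthonormalBasis.coe_toBasis_repr_apply, OrthonormalBasis.repr_apply_apply,
    OrthonormalBasis.coe_toBasis]

theorem LinearMap.trace_eq_sum_repr {V κ : Type*} [AddCommGroup V] [Module ℂ V] [Fintype κ]
    (b : Basis κ ℂ V) (f : V →ₗ[ℂ] V) :
    LinearMap.trace ℂ V f = ∑ i, b.repr (f (b i)) i := by
  classical
  simp [LinearMap.trace_eq_matrix_trace ℂ b, Matrix.trace, LinearMap.toMatrix_apply]

theorem LinearMap.exists_comp_eq_of_ker_le {K E F G : Type*} [Field K] [AddCommGroup E]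
    [Module K E] [AddCommGroup F] [Module K F] [AddCommGroup G] [Module K G]
    (f : E →ₗ[K] F) (h : E →ₗ[K] G) (hle : LinearMap.ker f ≤ LinearMap.ker h) :
    ∃ g : F →ₗ[K] G, ∀ x, g (f x) = h x := by
  obtain ⟨g, hg⟩ := LinearMap.exists_extend
    (((LinearMap.ker f).liftQ h hle) ∘ₗ f.quotKerEquivRange.symm.toLinearMap)
  refine ⟨g, fun x => ?_⟩
  have := LinearMap.congr_fun hg ⟨f x, x, rfl⟩
  simp only [LinearMap.comp_apply, Submodule.subtype_apply, LinearEquiv.coe_coe] at this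
  rw [this]
  have h2 : f.quotKerEquivRange.symm ⟨f x, x, rfl⟩ = (LinearMap.ker f).mkQ x := by
    rw [LinearEquiv.symm_apply_eq]; rfl
  rw [h2]; simp

/-- `P` sends `∑ V_i u_i` to `∑ V_i c u_i`. This is well defined: if the first sum vanishes, the
second is orthogonal to the range of every `V_j`, yet lies in their span. -/
theorem Matrix.exists_mul_eq_mul_of_commute {n m : ℕ} {ι : Type*} [Fintype ι]
    (V : ι → Matrix (Fin m) (Fin n) ℂ) (c : Matrix (Fin n) (Fin n) ℂ)
    (hc : ∀ i j, (V i)ᴴ * V j * c = c * ((V i)ᴴ * V j)) :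
    ∃ P : Matrix (Fin m) (Fin m) ℂ, ∀ i, P * V i = V i * c := by
  classical
  let f : (ι → Fin n → ℂ) →ₗ[ℂ] (Fin m → ℂ) :=
    ∑ i, (V i).mulVecLin ∘ₗ LinearMap.proj i
  let h : (ι → Fin n → ℂ) →ₗ[ℂ] (Fin m → ℂ) :=
    ∑ i, (V i * c).mulVecLin ∘ₗ LinearMap.proj i
  have hf : ∀ u, f u = ∑ i, V i *ᵥ u i := fun u => by simp [f]
  have hh : ∀ u, h u = ∑ i, (V i * c) *ᵥ u i := fun u => by simp [h]
  have hle : LinearMap.ker f ≤ LinearMap.ker h := by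
    intro u hu
    rw [LinearMap.mem_ker] at hu ⊢
    have key : ∀ j, (V j)ᴴ *ᵥ h u = 0 := fun j => by
      rw [hh, Matrix.mulVec_sum]
      calc ∑ i, (V j)ᴴ *ᵥ ((V i * c) *ᵥ u i) = ∑ i, c *ᵥ ((V j)ᴴ *ᵥ (V i *ᵥ u i)) := by
            refine Finset.sum_congr rfl fun i _ => ?_
            simp only [Matrix.mulVec_mulVec]
            rw [← Matrix.mul_assoc, hc]
        _ = 0 := by
            rw [← Matrix.mulVec_sum, ← Matrix.mulVec_sum, ← hf, hu]; simp
    rw [← dotProduct_star_self_eq_zero]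
    nth_rewrite 2 [hh]
    rw [dotProduct_sum]
    refine Finset.sum_eq_zero fun i _ => ?_
    have hstar : star (h u) ᵥ* V i = star ((V i)ᴴ *ᵥ h u) := by
      rw [Matrix.star_mulVec, Matrix.conjTranspose_conjTranspose]
    rw [← Matrix.mulVec_mulVec, Matrix.dotProduct_mulVec, hstar, key, star_zero, zero_dotProduct]
  obtain ⟨g, hg⟩ := f.exists_comp_eq_of_ker_le h hle
  refine ⟨LinearMap.toMatrix' g, fun i => ?_⟩
  refine Matrix.toLin'.injective (LinearMap.ext fun x => ?_)
  have := hg (Pi.single i x)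
  rw [hf, hh, Finset.sum_eq_single i (by intro j _ hj; simp [Pi.single_eq_of_ne hj]) (by simp),
    Finset.sum_eq_single i (by intro j _ hj; simp [Pi.single_eq_of_ne hj]) (by simp)] at this
  simpa [Matrix.toLin'_mul] using this

/-! ### The regular trace: a faithful positive trace on `A`. -/

namespace StarSubalgebra

variable {n : ℕ} (A : StarSubalgebra ℂ (Matrix (Fin n) (Fin n) ℂ))

instance finiteDimensional_matrix : FiniteDimensional ℂ A :=
  inferInstanceAs (FiniteDimensional ℂ (Subalgebra.toSubmodule A.toSubalgebra))

theorem exists_basis_repr_eq_trace :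
    ∃ b : Basis (Fin (finrank ℂ A)) ℂ A, ∀ x i,
      b.repr x i = ((b i : Matrix (Fin n) (Fin n) ℂ)ᴴ * (x : Matrix (Fin n) (Fin n) ℂ)).trace :=
  exists_basis_repr_eq_inner (V := A)
    { inner := fun x y : A =>
        ((x : Matrix (Fin n) (Fin n) ℂ)ᴴ * (y : Matrix (Fin n) (Fin n) ℂ)).trace
      conj_inner_symm := fun x y => by
        rw [starRingEnd_apply, ← Matrix.trace_conjTranspose]; simp
      re_inner_nonneg := fun x =>
        (Complex.nonneg_iff.1 (Matrix.posSemidef_conjTranspose_mul_self _).trace_nonneg).1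
      add_left := fun x y z => by simp [add_mul]
      smul_left := fun x y r => by simp
      definite := fun x hx => Subtype.ext (Matrix.trace_conjTranspose_mul_self_eq_zero_iff.1 hx) }

/-- The trace of left multiplication on `A`. -/
noncomputable def regularTrace : A →ₗ[ℂ] ℂ :=
  LinearMap.trace ℂ A ∘ₗ (Algebra.lmul ℂ A).toLinearMap

theorem regularTrace_apply (x : A) :
    A.regularTrace x = LinearMap.trace ℂ A (LinearMap.mulLeft ℂ x) := rfl

theorem regularTrace_one : A.regularTrace 1 = finrank ℂ A := by
  rw [regularTrace_apply, LinearMap.mulLeft_one, LinearMap.trace_id]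

theorem regularTrace_mul_comm (x y : A) : A.regularTrace (x * y) = A.regularTrace (y * x) := by
  simp only [regularTrace_apply, LinearMap.mulLeft_mul]
  exact LinearMap.trace_mul_comm ℂ _ _

theorem exists_regularTrace_eq_sum :
    ∃ e : Basis (Fin (finrank ℂ A)) ℂ A, ∀ x : A, A.regularTrace x =
      ∑ i, ((e i : Matrix (Fin n) (Fin n) ℂ)ᴴ * ((x : Matrix (Fin n) (Fin n) ℂ) * e i)).trace := by
  obtain ⟨e, he⟩ := A.exists_basis_repr_eq_trace
  refine ⟨e, fun x => ?_⟩
  rw [regularTrace_apply, LinearMap.trace_eq_sum_repr e]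
  simp [he]

theorem regularTrace_star (x : A) : A.regularTrace (star x) = star (A.regularTrace x) := by
  obtain ⟨e, he⟩ := A.exists_regularTrace_eq_sum
  rw [he, he, star_sum]
  refine Finset.sum_congr rfl fun i _ => ?_
  rw [← Matrix.trace_conjTranspose]
  simp [Matrix.star_eq_conjTranspose, Matrix.mul_assoc]

theorem exists_regularTrace_star_mul_self_eq_sum :
    ∃ e : Basis (Fin (finrank ℂ A)) ℂ A, ∀ x : A, A.regularTrace (star x * x) =
      ∑ i, (((x * e i : A) : Matrix (Fin n) (Fin n) ℂ)ᴴ *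
        ((x * e i : A) : Matrix (Fin n) (Fin n) ℂ)).trace := by
  obtain ⟨e, he⟩ := A.exists_regularTrace_eq_sum
  refine ⟨e, fun x => ?_⟩
  rw [he]
  simp [Matrix.star_eq_conjTranspose, Matrix.mul_assoc]

theorem regularTrace_star_mul_self_nonneg (x : A) : 0 ≤ A.regularTrace (star x * x) := by
  obtain ⟨e, he⟩ := A.exists_regularTrace_star_mul_self_eq_sum
  rw [he]
  exact Finset.sum_nonneg fun i _ => (Matrix.posSemidef_conjTranspose_mul_self _).trace_nonneg

theorem eq_zero_of_regularTrace_star_mul_self {x : A} (hx : A.regularTrace (star x * x) = 0) :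
    x = 0 := by
  obtain ⟨e, he⟩ := A.exists_regularTrace_star_mul_self_eq_sum
  rw [he, Finset.sum_eq_zero_iff_of_nonneg fun i _ =>
    (Matrix.posSemidef_conjTranspose_mul_self _).trace_nonneg] at hx
  have h0 : LinearMap.mulLeft ℂ x = 0 := e.ext fun i =>
    Subtype.ext (Matrix.trace_conjTranspose_mul_self_eq_zero_iff.1 (hx i (Finset.mem_univ i)))
  simpa using LinearMap.congr_fun h0 1

theorem exists_basis_repr_eq_regularTrace :
    ∃ a : Basis (Fin (finrank ℂ A)) ℂ A, ∀ x i, a.repr x i = A.regularTrace (star (a i) * x) :=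
  exists_basis_repr_eq_inner (V := A)
    { inner := fun x y : A => A.regularTrace (star x * y)
      conj_inner_symm := fun x y => by
        rw [starRingEnd_apply, ← regularTrace_star]; simp
      re_inner_nonneg := fun x =>
        (Complex.nonneg_iff.1 (A.regularTrace_star_mul_self_nonneg x)).1
      add_left := fun x y z => by simp [add_mul]
      smul_left := fun x y r => by simp
      definite := fun x hx => A.eq_zero_of_regularTrace_star_mul_self hx }

end StarSubalgebra

/-! ### Averaging over a regular orthonormal basis. -/

namespace StarSubalgebra

variable {n : ℕ} {A : StarSubalgebra ℂ (Matrix (Fin n) (Fin n) ℂ)}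
  {a : Basis (Fin (finrank ℂ A)) ℂ A}

/-- Pairing the sum with any `y` under the regular trace computes the trace of left multiplication
by `y`; faithfulness concludes. -/
theorem sum_mul_star_eq_one (ha : ∀ x i, a.repr x i = A.regularTrace (star (a i) * x)) :
    ∑ i, a i * star (a i) = 1 := by
  have key : ∀ y, A.regularTrace ((∑ i, a i * star (a i)) * y) = A.regularTrace y := fun y => by
    rw [A.regularTrace_apply y, LinearMap.trace_eq_sum_repr a, Finset.sum_mul, map_sum]
    refine Finset.sum_congr rfl fun i _ => ?_
    rw [ha, LinearMap.mulLeft_apply, mul_assoc, regularTrace_mul_comm, mul_assoc]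
  rw [← sub_eq_zero]
  refine A.eq_zero_of_regularTrace_star_mul_self ?_
  rw [regularTrace_mul_comm, sub_mul, map_sub, key, one_mul, sub_self]

theorem sum_repr_one_mul_star (ha : ∀ x i, a.repr x i = A.regularTrace (star (a i) * x)) :
    ∑ i, a.repr 1 i * star (a.repr 1 i) = finrank ℂ A := by
  have h : A.regularTrace (∑ i, a.repr 1 i • a i) = finrank ℂ A := by
    rw [a.sum_repr, regularTrace_one]
  rw [map_sum] at h
  rw [← h]
  refine Finset.sum_congr rfl fun i _ => ?_
  rw [map_smul, smul_eq_mul, ha, mul_one, ← regularTrace_star, star_star]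

/-- Moving `x` across either side of the sum produces the same coefficients: right multiplication by
`star x` is adjoint to right multiplication by `x`. -/
theorem commute_sum_star_mul_mul (ha : ∀ x i, a.repr x i = A.regularTrace (star (a i) * x))
    (x : A) (Y : Matrix (Fin n) (Fin n) ℂ) :
    Commute (x : Matrix (Fin n) (Fin n) ℂ)
      (∑ i, (a i : Matrix (Fin n) (Fin n) ℂ)ᴴ * Y * a i) := by
  have h1 : ∀ i, (a i : Matrix (Fin n) (Fin n) ℂ) * x =
      ∑ k, A.regularTrace (star (a k) * (a i * x)) • (a k : Matrix (Fin n) (Fin n) ℂ) := fun i => by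
    have h := congrArg (Subtype.val) (a.sum_repr (a i * x))
    simp only [ha] at h
    simpa using h.symm
  have h2 : ∀ k, (x : Matrix (Fin n) (Fin n) ℂ) * (a k : Matrix (Fin n) (Fin n) ℂ)ᴴ =
      ∑ i, A.regularTrace (star (a k) * (a i * x)) •
        (a i : Matrix (Fin n) (Fin n) ℂ)ᴴ := fun k => by
    have h := congrArg (fun y : A => (y : Matrix (Fin n) (Fin n) ℂ)ᴴ)
      (a.sum_repr (a k * star x))
    simp only [ha] at h
    have h3 : ∀ i, star (A.regularTrace (star (a i) * (a k * star x))) =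
        A.regularTrace (star (a k) * (a i * x)) := fun i => by
      rw [← regularTrace_star, star_mul, star_mul, star_star, star_star, mul_assoc,
        regularTrace_mul_comm, mul_assoc]
    simpa [Matrix.conjTranspose_sum, Matrix.star_eq_conjTranspose, ← h3] using h.symm
  rw [commute_iff_eq, Finset.mul_sum, Finset.sum_mul]
  calc ∑ k, (x : Matrix (Fin n) (Fin n) ℂ) * ((a k : Matrix (Fin n) (Fin n) ℂ)ᴴ * Y * a k)
      = ∑ k, ∑ i, A.regularTrace (star (a k) * (a i * x)) •
          ((a i : Matrix (Fin n) (Fin n) ℂ)ᴴ * Y * a k) := by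
        refine Finset.sum_congr rfl fun k _ => ?_
        rw [← mul_assoc, ← mul_assoc, h2, Finset.sum_mul, Finset.sum_mul]
        simp
    _ = ∑ i, ∑ k, A.regularTrace (star (a k) * (a i * x)) •
          ((a i : Matrix (Fin n) (Fin n) ℂ)ᴴ * Y * a k) := Finset.sum_comm
    _ = ∑ i, (a i : Matrix (Fin n) (Fin n) ℂ)ᴴ * Y * a i * (x : Matrix (Fin n) (Fin n) ℂ) := by
        refine Finset.sum_congr rfl fun i _ => ?_
        rw [mul_assoc _ (a i : Matrix (Fin n) (Fin n) ℂ), h1, Finset.mul_sum]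
        simp

theorem trace_sum_star_mul_mul_mul (ha : ∀ x i, a.repr x i = A.regularTrace (star (a i) * x))
    (Y c : Matrix (Fin n) (Fin n) ℂ) (hc : ∀ x : A, Commute (x : Matrix (Fin n) (Fin n) ℂ) c) :
    ((∑ i, (a i : Matrix (Fin n) (Fin n) ℂ)ᴴ * Y * a i) * c).trace = (Y * c).trace := by
  have h1 : ∑ i, (a i : Matrix (Fin n) (Fin n) ℂ) * (a i : Matrix (Fin n) (Fin n) ℂ)ᴴ = 1 := by
    simpa [Matrix.star_eq_conjTranspose] using congrArg Subtype.val (sum_mul_star_eq_one ha)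
  rw [Finset.sum_mul, Matrix.trace_sum, ← mul_one (Y * c), ← h1, Finset.mul_sum, Matrix.trace_sum]
  refine Finset.sum_congr rfl fun i _ => ?_
  rw [mul_assoc, (hc (a i)).eq, mul_assoc, Matrix.trace_mul_comm, ← mul_assoc, mul_assoc Y,
    ← mul_assoc Y]
  simp only [mul_assoc]

/-- If `Y` is orthogonal to the traceless part of the commutant of `A`, its average over a
regular orthonormal basis of `A` is scalar. -/
theorem sum_star_mul_mul_eq_smul_one (ha : ∀ x i, a.repr x i = A.regularTrace (star (a i) * x))
    (Y : Matrix (Fin n) (Fin n) ℂ) (τ : ℂ)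
    (hY : ∀ c : Matrix (Fin n) (Fin n) ℂ, (∀ x : A, Commute (x : Matrix (Fin n) (Fin n) ℂ) c) →
      (Y * c).trace = τ * c.trace) :
    ∑ i, (a i : Matrix (Fin n) (Fin n) ℂ)ᴴ * Y * a i = τ • 1 := by
  rw [← sub_eq_zero]
  set R := (∑ i, (a i : Matrix (Fin n) (Fin n) ℂ)ᴴ * Y * a i) - τ • 1 with hR
  have hcomm : ∀ x : A, Commute (x : Matrix (Fin n) (Fin n) ℂ) R := fun x =>
    (commute_sum_star_mul_mul ha x Y).sub_right ((Commute.one_right _).smul_right _)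
  have hcomm' : ∀ x : A, Commute (x : Matrix (Fin n) (Fin n) ℂ) Rᴴ := fun x => by
    have := (hcomm (star x)).star_star
    simpa [Matrix.star_eq_conjTranspose] using this
  -- `R` lies in the commutant and is orthogonal to it, so `Tr(R Rᴴ) = 0`.
  rw [← Matrix.trace_conjTranspose_mul_self_eq_zero_iff, Matrix.trace_mul_comm]
  nth_rewrite 1 [hR]
  rw [sub_mul, Matrix.trace_sub, trace_sum_star_mul_mul_mul ha _ _ hcomm', hY _ hcomm']
  simp

end StarSubalgebra

/-! ### The dimension bound from quasiorthogonality. -/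

theorem Matrix.norm_trace_sq_le {n : ℕ} (X : Matrix (Fin n) (Fin n) ℂ) :
    ‖X.trace‖ ^ 2 ≤ n * (Xᴴ * X).trace.re := by
  have h1 : ‖X.trace‖ ≤ ∑ i, ‖X i i‖ := norm_sum_le _ _
  have h2 : (∑ i, ‖X i i‖) ^ 2 ≤ n * ∑ i, ‖X i i‖ ^ 2 := by
    simpa using sq_sum_le_card_mul_sum_sq (s := Finset.univ) (f := fun i => ‖X i i‖)
  have h3 : (Xᴴ * X).trace.re = ∑ i, ∑ j, ‖X j i‖ ^ 2 := by
    simp only [Matrix.trace, Matrix.diag, Matrix.mul_apply, Matrix.conjTranspose_apply,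
      Complex.re_sum]
    refine Finset.sum_congr rfl fun i _ => Finset.sum_congr rfl fun j _ => ?_
    rw [← Complex.normSq_eq_norm_sq, Complex.star_def, ← Complex.normSq_eq_conj_mul_self,
      Complex.ofReal_re]
  have h4 : ∑ i, ‖X i i‖ ^ 2 ≤ (Xᴴ * X).trace.re := by
    rw [h3]
    exact Finset.sum_le_sum fun i _ =>
      Finset.single_le_sum (f := fun j => ‖X j i‖ ^ 2) (fun j _ => by positivity)
        (Finset.mem_univ i)
  calc ‖X.trace‖ ^ 2 ≤ (∑ i, ‖X i i‖) ^ 2 := by gcongr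
    _ ≤ n * ∑ i, ‖X i i‖ ^ 2 := h2
    _ ≤ _ := by gcongr

/-- If `B` is quasiorthogonal to the commutant of `A`, then `dim B ≤ dim A`. -/
theorem StarSubalgebra.finrank_le_of_trace_mul_eq {n : ℕ}
    (A B : StarSubalgebra ℂ (Matrix (Fin n) (Fin n) ℂ))
    (hAB : ∀ b ∈ B, ∀ c : Matrix (Fin n) (Fin n) ℂ,
      (∀ x : A, Commute (x : Matrix (Fin n) (Fin n) ℂ) c) →
      (n : ℂ) * (b * c).trace = b.trace * c.trace) :
    finrank ℂ B ≤ finrank ℂ A := by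
  obtain ⟨a, ha⟩ := A.exists_basis_repr_eq_regularTrace
  obtain ⟨b', hb'⟩ := B.exists_basis_repr_eq_trace
  rcases Nat.eq_zero_or_pos n with rfl | hn
  · have : Subsingleton B := inferInstance
    rw [finrank_zero_of_subsingleton]
    exact Nat.zero_le _
  have hn0 : (n : ℂ) ≠ 0 := by exact_mod_cast hn.ne'
  set b : Fin (finrank ℂ B) → Matrix (Fin n) (Fin n) ℂ := fun k => b' k with hb
  have horth : ∀ j k, ((b j)ᴴ * b k).trace = if j = k then 1 else 0 := fun j k => by
    rw [hb, ← hb' (b' k) j, b'.repr_self, Finsupp.single_apply]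
    simp [eq_comm]
  have hmem : ∀ j k, (b j)ᴴ * b k ∈ B := fun j k => mul_mem (star_mem (b' j).2) (b' k).2
  have havg : ∀ j k, ∑ i, (a i : Matrix (Fin n) (Fin n) ℂ)ᴴ * ((b j)ᴴ * b k) * a i =
      (if j = k then (n : ℂ)⁻¹ else 0) • 1 := fun j k =>
    sum_star_mul_mul_eq_smul_one ha _ _ fun c hc => by
      have h := hAB _ (hmem j k) c hc
      rw [horth] at h
      rw [← mul_right_inj' hn0, h, ← mul_assoc]
      split_ifs <;> simp [hn0]
  set X : Fin (finrank ℂ A) → Matrix (Fin n) (Fin n) ℂ :=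
    fun i => ∑ k, b k * (a i : Matrix (Fin n) (Fin n) ℂ) * (b k)ᴴ with hX
  -- Averaging over `i` kills the terms `j ≠ k`; each diagonal term contributes `1/n`.
  have hXtr : ∑ i, ((X i)ᴴ * X i).trace = (n : ℂ)⁻¹ * finrank ℂ B := by
    have hexp : ∀ i, ((X i)ᴴ * X i).trace = ∑ j, ∑ k,
        (b j * ((a i : Matrix (Fin n) (Fin n) ℂ)ᴴ * ((b j)ᴴ * b k) * a i) * (b k)ᴴ).trace := by
      intro i
      simp only [hX, Matrix.conjTranspose_sum, Finset.sum_mul_sum, Matrix.trace_sum]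
      refine Finset.sum_congr rfl fun j _ => Finset.sum_congr rfl fun k _ => ?_
      simp only [Matrix.conjTranspose_mul, Matrix.conjTranspose_conjTranspose, mul_assoc]
    simp only [hexp]
    rw [Finset.sum_comm]
    have hin : ∀ j, ∑ i, ∑ k,
        (b j * ((a i : Matrix (Fin n) (Fin n) ℂ)ᴴ * ((b j)ᴴ * b k) * a i) * (b k)ᴴ).trace =
        (n : ℂ)⁻¹ := fun j => by
      rw [Finset.sum_comm, Finset.sum_eq_single j]
      · rw [← Matrix.trace_sum, ← Finset.sum_mul, ← Finset.mul_sum, havg, if_pos rfl]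
        rw [Matrix.trace_mul_comm]
        simp [horth]
      · intro k _ hk
        rw [← Matrix.trace_sum, ← Finset.sum_mul, ← Finset.mul_sum, havg, if_neg hk.symm]
        simp
      · simp
    simp only [hin]
    simp [mul_comm]
  -- Expanding `1` in the basis `a` turns `∑ b_k b_k^*`, of trace `dim B`, into a combination of the
  -- `X_i`.
  have hsum : (finrank ℂ B : ℂ) = ∑ i, a.repr 1 i * (X i).trace := by
    have hone : ∑ i, a.repr 1 i • (a i : Matrix (Fin n) (Fin n) ℂ) = 1 := by
      have h := congrArg A.subtype (a.sum_repr 1)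
      rw [map_sum] at h
      exact h
    have h1 : ∑ i, a.repr 1 i • X i = ∑ k, b k * (b k)ᴴ := by
      simp only [hX, Finset.smul_sum]
      rw [Finset.sum_comm]
      refine Finset.sum_congr rfl fun k _ => ?_
      calc ∑ i, a.repr 1 i • (b k * (a i : Matrix (Fin n) (Fin n) ℂ) * (b k)ᴴ)
          = b k * (∑ i, a.repr 1 i • (a i : Matrix (Fin n) (Fin n) ℂ)) * (b k)ᴴ := by
            simp [Finset.mul_sum, Finset.sum_mul]
        _ = b k * (b k)ᴴ := by rw [hone, mul_one]
    have h2 := congrArg Matrix.trace h1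
    simp only [Matrix.trace_sum, Matrix.trace_smul, smul_eq_mul] at h2
    rw [h2, Finset.sum_congr rfl fun k _ => (Matrix.trace_mul_comm (b k) (b k)ᴴ).trans (horth k k)]
    simp
  have hcoef : ∑ i, ‖a.repr 1 i‖ ^ 2 = finrank ℂ A := by
    have h := congrArg Complex.re (sum_repr_one_mul_star ha)
    rw [Complex.re_sum] at h
    rw [← Complex.natCast_re, ← h]
    refine Finset.sum_congr rfl fun i _ => ?_
    rw [Complex.star_def, Complex.mul_conj, Complex.normSq_eq_norm_sq, Complex.ofReal_re]
  have hXre : ∑ i, ‖(X i).trace‖ ^ 2 ≤ (finrank ℂ B : ℝ) := by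
    have h := congrArg Complex.re hXtr
    rw [Complex.re_sum] at h
    calc ∑ i, ‖(X i).trace‖ ^ 2 ≤ ∑ i, n * ((X i)ᴴ * X i).trace.re :=
          Finset.sum_le_sum fun i _ => (X i).norm_trace_sq_le
      _ = n * ((n : ℂ)⁻¹ * finrank ℂ B).re := by rw [← Finset.mul_sum, h]
      _ = finrank ℂ B := by
          have : ((n : ℂ)⁻¹ * finrank ℂ B) = (((n : ℝ)⁻¹ * finrank ℂ B : ℝ) : ℂ) := by push_cast; rfl
          rw [this, Complex.ofReal_re]
          field_simp
  have hle : (finrank ℂ B : ℝ) ≤ ∑ i, ‖a.repr 1 i‖ * ‖(X i).trace‖ := by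
    have h := congrArg norm hsum
    rw [Complex.norm_natCast] at h
    rw [h]
    simpa only [norm_mul] using norm_sum_le Finset.univ fun i => a.repr 1 i * (X i).trace
  have hfin : (finrank ℂ B : ℝ) ^ 2 ≤ finrank ℂ A * finrank ℂ B :=
    calc (finrank ℂ B : ℝ) ^ 2 ≤ (∑ i, ‖a.repr 1 i‖ * ‖(X i).trace‖) ^ 2 := by gcongr
      _ ≤ (∑ i, ‖a.repr 1 i‖ ^ 2) * ∑ i, ‖(X i).trace‖ ^ 2 :=
          Finset.sum_mul_sq_le_sq_mul_sq _ _ _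
      _ ≤ finrank ℂ A * finrank ℂ B := by rw [hcoef]; gcongr
  rcases Nat.eq_zero_or_pos (finrank ℂ B) with h0 | h0
  · omega
  · have h0' : (0 : ℝ) < finrank ℂ B := by exact_mod_cast h0
    have : (finrank ℂ B : ℝ) ≤ finrank ℂ A := by nlinarith
    exact_mod_cast this

/-! ### Privatization gives quasiorthogonality. -/

theorem QuantumChannel.trace_mul_eq_of_privatizesToState {n m : ℕ} {Φ : QuantumChannel n m}
    {ι : Type*} [Fintype ι] {V : ι → Matrix (Fin m) (Fin n) ℂ} (hV : Φ.IsKrausFamily V)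
    {B : StarSubalgebra ℂ (Matrix (Fin n) (Fin n) ℂ)} (hB : Φ.PrivatizesToState B)
    {b : Matrix (Fin n) (Fin n) ℂ} (hb : b ∈ B) {c : Matrix (Fin n) (Fin n) ℂ}
    (hc : ∀ i j, (V i)ᴴ * V j * c = c * ((V i)ᴴ * V j)) :
    (n : ℂ) * (b * c).trace = b.trace * c.trace := by
  obtain ⟨ρ, -, -, hρ⟩ := hB
  obtain ⟨P, hP⟩ := Matrix.exists_mul_eq_mul_of_commute V c hc
  have key : ∀ Y ∈ B, (Y * c).trace = Y.trace * (P * ρ).trace := fun Y hY => by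
    have hPhi : P * Φ.toLinearMap Y = ∑ i, V i * (c * Y) * (V i)ᴴ := by
      rw [hV, Finset.mul_sum]
      refine Finset.sum_congr rfl fun i _ => ?_
      rw [← Matrix.mul_assoc, ← Matrix.mul_assoc, hP, Matrix.mul_assoc (V i)]
    rw [Matrix.trace_mul_comm, ← Φ.trace_map, hV, ← hPhi, hρ Y hY, Matrix.mul_smul,
      Matrix.trace_smul, smul_eq_mul]
  -- `Y = 1` gives `Tr(c) = n Tr(Pρ)`, which eliminates `P` and `ρ`.
  have h1 := key 1 (one_mem B)
  rw [one_mul, Matrix.trace_one, Fintype.card_fin] at h1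
  rw [key b hb, h1]
  ring

/-- The unital ⋆-subalgebra generated by the operators `V_i^* V_j`. -/
noncomputable def krausStarSubalgebra {n m : ℕ} {ι : Type*}
    (V : ι → Matrix (Fin m) (Fin n) ℂ) : StarSubalgebra ℂ (Matrix (Fin n) (Fin n) ℂ) where
  toSubalgebra := Algebra.adjoin ℂ (krausProducts V)
  star_mem' {x} hx := by
    induction hx using Algebra.adjoin_induction with
    | mem x hx =>
      obtain ⟨⟨i, j⟩, rfl⟩ := hx
      refine Algebra.subset_adjoin ⟨(j, i), ?_⟩
      simp [Matrix.star_eq_conjTranspose]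
    | algebraMap r =>
      change star (algebraMap ℂ (Matrix (Fin n) (Fin n) ℂ) r) ∈ Algebra.adjoin ℂ (krausProducts V)
      rw [← algebraMap_star_comm r]
      exact Subalgebra.algebraMap_mem _ _
    | add x y _ _ hx hy => rw [star_add]; exact Subalgebra.add_mem _ hx hy
    | mul x y _ _ hx hy => rw [star_mul]; exact Subalgebra.mul_mem _ hy hx

theorem adjoin_krausProducts_le_doubleCommutant {n m : ℕ} {ι : Type*}
    (V : ι → Matrix (Fin m) (Fin n) ℂ) :
    Algebra.adjoin ℂ (krausProducts V) ≤ doubleCommutant (krausProducts V) :=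
  Algebra.adjoin_le (Set.subset_centralizer_centralizer (S := krausProducts V))

theorem mainTheorem10 {n m : ℕ} (Φ : QuantumChannel n m) {ι : Type*} [Fintype ι]
    (V : ι → Matrix (Fin m) (Fin n) ℂ) (hV : Φ.IsKrausFamily V)
    (B : StarSubalgebra ℂ (Matrix (Fin n) (Fin n) ℂ)) (hB : Φ.PrivatizesToState B) :
    Module.finrank ℂ B ≤ Module.finrank ℂ (doubleCommutant (krausProducts V)) ∧
      Module.finrank ℂ B ≤ Module.finrank ℂ (Algebra.adjoin ℂ (krausProducts V)) := by
  have h : finrank ℂ B ≤ finrank ℂ (Algebra.adjoin ℂ (krausProducts V)) :=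
    StarSubalgebra.finrank_le_of_trace_mul_eq (krausStarSubalgebra V) B fun b hb c hc =>
      QuantumChannel.trace_mul_eq_of_privatizesToState hV hB hb fun i j =>
        (hc ⟨_, Algebra.subset_adjoin ⟨(i, j), rfl⟩⟩).eq
  have : FiniteDimensional ℂ (doubleCommutant (krausProducts V)) :=
    inferInstanceAs (FiniteDimensional ℂ (Subalgebra.toSubmodule (doubleCommutant (krausProducts V))))
  have hle := adjoin_krausProducts_le_doubleCommutant V
  exact ⟨h.trans (LinearMap.finrank_le_finrank_of_injective
    (f := (Subalgebra.inclusion hle).toLinearMap) (Subalgebra.inclusion_injective hle)), h⟩
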